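/- **Theorem (convergence of finite dimensional distributions).** Let $\mathbb T_2=(\mathbb R/\mathbb Z)^2$ be the flat two dimensional torus, let $\ell$ be its normalized Lebesgue measure, and let $(e_n)_{n\ge1}$ be an orthonormal basis, in the space of functions in $L^2(\ell)$ with zero average, of eigenvectors of $-\Delta$, with eigenvalues $\lambda_n>0$. For $m\in\mathbb R$ and $\epsilon>0$ put $$G_{m,\epsilon}(x,y)=\sum_{n}\lambda_n^{-m/2}e^{-\epsilon\lambda_n}e_n(x)\overline{e_n(y)} .$$ Let $\nu$ be a probability measure on $\mathbb R$ with compact support and let $\beta>0$. For $N\ge1$ let $\mu^N_{\beta,\epsilon}$ be the probability measure on $(\mathbb R\times\mathbb T_2)^N$ $$\mu^N_{\beta,\epsilon}(d\gamma,dx)=\frac1{Z^N_{\beta,\epsilon}}\exp\Bigl(-\frac{\beta}{N}\cdot\frac12\sum_{j\ne k}\gamma_j\gamma_kG_{m,\epsilon}(x_j,x_k)\Bigr)\,(\nu\otimes\ell)^{\otimes N}(d\gamma,dx),$$ where $Z^N_{\beta,\epsilon}$ is the normalization factor. Assume $m<2$ and $\beta>0$. Then there is $C_0>0$, depending only on $m$,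 $\beta$ and $\nu$, such that the following holds for every $C\ge C_0$ and every sequence $\epsilon(N)>0$ with $\epsilon(N)\to0$ as $N\to\infty$ and $$\epsilon(N)\ge C(\log N)^{-\frac{2}{2-m}}\qquad\text{for all large }N.$$ The measures $\mu^N_{\beta,\epsilon(N)}$ are well defined probability measures and, for every $k$, the law of the first $k$ pairs $(\gamma_1,x_1),\dots,(\gamma_k,x_k)$ under $\mu^N_{\beta,\epsilon(N)}$ converges weakly to $(\nu\otimes\ell)^{\otimes k}$ as $N\to\infty$. In particular, propagation of chaos holds: the measures $\mu^N_{\beta,\epsilon(N)}$ are exchangeable and, for all $k$ and all bounded continuous $\varphi_1,\dots,\varphi_k:\mathbb R\times\mathbb T_2\to\mathbb R$, $$\int\prod_{i=1}^k\varphi_i(\gamma_i,x_i)\,d\mu^N_{\beta,\epsilon(N)}\longrightarrow\prod_{i=1}^k\int\varphi_i\,d(\nu\otimes\ell).$$ -/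

import Mathlib

open MeasureTheory Filter Topology

noncomputable section

namespace PointVortex

/-- The flat two dimensional torus `(ℝ/ℤ)²`. -/
abbrev Torus : Type := UnitAddTorus (Fin 2)

/-- The normalized Lebesgue measure `ℓ` on the torus. -/
def ell : Measure Torus := Measure.pi fun _ : Fin 2 => AddCircle.haarAddCircle

instance : IsProbabilityMeasure ell := by
  unfold ell
  infer_instance

/-- State of one vortex: the pair (intensity, position). -/
abbrev Vortex : Type := ℝ × Torus

/-- The nonzero frequencies, which index the eigenvectors `x ↦ exp (2π i n ⬝ x)`
(`UnitAddTorus.mFourier n`) of `-Δ` on functions on the torus with zero average; they form an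
orthonormal basis with respect to `ℓ`. -/
abbrev Freq : Type := {n : Fin 2 → ℤ // n ≠ 0}

/-- The eigenvalue `4π²|n|²` of `-Δ` on the eigenvector of frequency `n`. -/
def eigenvalue (n : Freq) : ℝ :=
  (2 * Real.pi) ^ 2 * ∑ i, ((n.1 i : ℤ) : ℝ) ^ 2

/-- The regularized Green function
`G_{m,ε}(x, y) = ∑ₙ λₙ^(-m/2) exp (-ε λₙ) eₙ(x) conj (eₙ(y))`, the integral kernel with respect to
`ℓ` of `(-Δ)^(-m/2) exp (ε Δ)` on zero average functions. It does not depend on the choice of the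
orthonormal basis of eigenvectors. The frequencies `n` and `-n` contribute complex conjugate terms,
so the sum is the sum of the real parts; it converges absolutely for `ε > 0`. -/
def greenReg (m ε : ℝ) (x y : Torus) : ℝ :=
  ∑' n : Freq, eigenvalue n ^ (-(m / 2)) * Real.exp (-(ε * eigenvalue n)) *
    (UnitAddTorus.mFourier n.1 x * (starRingEnd ℂ) (UnitAddTorus.mFourier n.1 y)).re

/-- The Hamiltonian `½ ∑_{j ≠ k} γⱼ γₖ G_{m,ε}(Xⱼ, Xₖ)` of `N` vortices, where
`ω j = (γⱼ, Xⱼ)`. -/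
def hamiltonian (m ε : ℝ) (N : ℕ) (ω : Fin N → Vortex) : ℝ :=
  (1 / 2) * ∑ j, ∑ k ∈ Finset.univ.erase j,
    (ω j).1 * (ω k).1 * greenReg m ε (ω j).2 (ω k).2

/-- The regularized canonical measure with random intensities: the probability measure with density
`exp (-(β/N) H) / Z` with respect to `(ν ⊗ ℓ)^{⊗ N}`, where `Z = ∫ exp (-(β/N) H)`. -/
def canonicalMeasure (m β ε : ℝ) (ν : Measure ℝ) (N : ℕ) : Measure (Fin N → Vortex) :=
  (Measure.pi fun _ : Fin N => ν.prod ell).tilted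
    fun ω => -(β / N) * hamiltonian m ε N ω

/-- The marginal law of the first `k` among `k + n` particles. -/
def firstMarginal {E : Type*} [MeasurableSpace E] (k n : ℕ) (P : Measure (Fin (k + n) → E)) :
    Measure (Fin k → E) :=
  P.map fun ω i => ω (Fin.castAdd n i)

/-- Weak convergence of probability measures: convergence of the integrals of all bounded continuous
functions. -/
def WeaklyConverges {E : Type*} [TopologicalSpace E] [MeasurableSpace E]
    (P : ℕ → Measure E) (Q : Measure E) : Prop :=
  ∀ f : BoundedContinuousFunction E ℝ,
    Tendsto (fun n => ∫ x, f x ∂(P n)) atTop (𝓝 (∫ x, f x ∂Q))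

/-- The laws `P N` on `E^N` are `ρ`-chaotic (propagation of chaos): they are exchangeable, and any
`k` particles become asymptotically independent with common law `ρ`. -/
def IsChaotic {E : Type*} [TopologicalSpace E] [MeasurableSpace E]
    (ρ : Measure E) (P : ∀ N : ℕ, Measure (Fin N → E)) : Prop :=
  (∀ (N : ℕ) (σ : Equiv.Perm (Fin N)), (P N).map (fun ω i => ω (σ i)) = P N) ∧
  ∀ (k : ℕ) (φ : Fin k → BoundedContinuousFunction E ℝ),
    Tendsto (fun n => ∫ ω, ∏ i, φ i (ω (Fin.castAdd n i)) ∂(P (k + n))) atTop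
      (𝓝 (∏ i, ∫ z, φ i z ∂ρ))

end PointVortex

end

/-! The Green function has zero mean and is positive definite, so the Gibbs density is bounded
uniformly in the configuration. Zero mean gives `∫ H = 0` under the product measure, hence `Z ≥ 1`
by Jensen. Positive definiteness gives `H ≥ -½ G(x,x) ∑ γⱼ²`, so with `|γ| ≤ R` almost surely the
density is at most `exp L`, where `L = β R² G(x,x) / 2`. Since `G(x,x)` grows at most like a power
of `1/ε`, the lower bound on `ε(N)` makes it polylogarithmic in `N`, so `L = o(N)`.

A density `exp (o(N))` cannot move the `k`-marginals of an exchangeable law. Cut the particles into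
`M`, of order `N/k`, disjoint blocks of size `k`. Under the product measure the values of a function
with `|F| ≤ B` on the blocks are independent, so their centred sum is sub-Gaussian with variance
proxy `M B²`. Jensen and the density bound turn this into `t M (E F - E₀ F) ≤ L + M B² t² / 2`,
where `E` and `E₀` are the Gibbs and product expectations. Divide by `t M`, take `t` small, then `N`
large (`integral_marginal_sub_le`, `tendsto_integral_marginal`). -/

open ProbabilityTheory

namespace PointVortex

/-! ### Exchangeable laws with bounded density: concentration over blocks. -/

section Blocks

variable {E : Type*} [MeasurableSpace E] (ρ : Measure E) [IsProbabilityMeasure ρ]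

/-- Distinct coordinates of a sample of a power of `ρ` form a sample of a power of `ρ`. -/
lemma pi_map_comp_injective {ι κ : Type*} [Fintype ι] [Fintype κ] {e : κ → ι}
    (he : Function.Injective e) :
    (Measure.pi fun _ : ι => ρ).map (fun ω j => ω (e j)) = Measure.pi fun _ : κ => ρ := by
  have h : iIndepFun (fun (i : ι) (ω : ι → E) => ω i) (Measure.pi fun _ : ι => ρ) :=
    iIndepFun_pi (X := fun _ => id) fun _ => aemeasurable_id
  rw [(h.precomp he).map_fun_eq_pi_map fun j => (measurable_pi_apply (e j)).aemeasurable]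
  congr 1
  ext1 j
  exact (measurePreserving_eval (fun _ : ι => ρ) (e j)).map_eq

lemma pi_map_curry {ι κ : Type*} [Fintype ι] [Fintype κ] :
    (Measure.pi fun _ : ι × κ => ρ).map (fun ω b i => ω (b, i)) =
      Measure.pi fun _ : ι => Measure.pi fun _ : κ => ρ := by
  have h := Measure.infinitePi_map_curry (ι := ι) (κ := κ) (fun _ _ => ρ)
  simp only [Measure.infinitePi_eq_pi] at h
  exact h

/-- Injectivity of `e` makes the blocks disjoint sets of coordinates. -/
lemma iIndepFun_blocks {ι κ τ : Type*} [Fintype ι] [Fintype κ] [Fintype τ] {e : ι × κ → τ}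
    (he : Function.Injective e) :
    iIndepFun (fun (b : ι) (ω : τ → E) (i : κ) => ω (e (b, i))) (Measure.pi fun _ : τ => ρ) := by
  rw [iIndepFun_iff_map_fun_eq_pi_map fun b => Measurable.aemeasurable (by fun_prop)]
  have h : (Measure.pi fun _ : τ => ρ).map (fun ω b i => ω (e (b, i))) =
      ((Measure.pi fun _ : τ => ρ).map (fun ω p => ω (e p))).map
        (fun (ω : ι × κ → E) b i => ω (b, i)) := by
    rw [Measure.map_map (by fun_prop) (by fun_prop)]
    rfl
  rw [h, pi_map_comp_injective ρ he, pi_map_curry]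
  congr 1
  ext1 b
  exact (pi_map_comp_injective ρ (he.comp (Prod.mk_right_injective b))).symm

/-- Sums over disjoint blocks of bounded functions of `κ` particles, under a measure whose density
with respect to the product measure is at most `exp L`. -/
lemma sum_integral_blocks_le {ι κ τ : Type*} [Fintype ι] [Fintype κ] [Fintype τ] {e : ι × κ → τ}
    (he : Function.Injective e) {g : (τ → E) → ℝ} {L : ℝ}
    (hgi : Integrable (fun ω => Real.exp (g ω)) (Measure.pi fun _ : τ => ρ))
    (hZ : 1 ≤ ∫ ω, Real.exp (g ω) ∂(Measure.pi fun _ : τ => ρ))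
    (hgL : ∀ᵐ ω ∂(Measure.pi fun _ : τ => ρ), g ω ≤ L)
    {F : (κ → E) → ℝ} (hF : Measurable F) {B : ℝ} (hB : ∀ z, |F z| ≤ B) {t : ℝ} :
    t * ∑ b, ∫ ω, (F (fun i => ω (e (b, i))) - ∫ z, F z ∂(Measure.pi fun _ : κ => ρ))
        ∂((Measure.pi fun _ : τ => ρ).tilted g) ≤
      L + Fintype.card ι * B ^ 2 * t ^ 2 / 2 := by
  set π := Measure.pi fun _ : τ => ρ with hπ
  set c := ∫ z, F z ∂(Measure.pi fun _ : κ => ρ) with hc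
  have : IsProbabilityMeasure (π.tilted g) := isProbabilityMeasure_tilted hgi
  set X : ι → (τ → E) → ℝ := fun b ω => F (fun i => ω (e (b, i))) - c with hX
  have hXm : ∀ b, Measurable (X b) := fun b => by fun_prop
  have hmean : ∀ b, ∫ ω, F (fun i => ω (e (b, i))) ∂π = c := fun b => by
    rw [hc, ← pi_map_comp_injective ρ (he.comp (Prod.mk_right_injective b)),
      integral_map (Measurable.aemeasurable (by fun_prop)) hF.aestronglyMeasurable]
    rfl
  have hind : iIndepFun X π :=
    (iIndepFun_blocks ρ he).comp (fun _ z => F z - c) fun _ => by fun_prop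
  -- Hoeffding's lemma for a variable with values in `[-B, B]`; the variance proxy is `B²`.
  have hsub : ∀ b, HasSubgaussianMGF (X b) ((‖B - -B‖₊ / 2) ^ 2) π := fun b => by
    have := hasSubgaussianMGF_of_mem_Icc (μ := π) (X := fun ω => F (fun i => ω (e (b, i))))
      (a := -B) (b := B) (Measurable.aemeasurable (by fun_prop)) (ae_of_all _ fun ω => abs_le.1 (hB _))
    rwa [hmean b] at this
  have hS := HasSubgaussianMGF.sum_of_iIndepFun hind (s := Finset.univ) fun b _ => hsub b
  have hXb : ∀ b ω, |X b ω| ≤ B + |c| := fun b ω =>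
    (abs_sub _ _).trans (add_le_add (hB _) le_rfl)
  have hXi : ∀ b, Integrable (X b) (π.tilted g) := fun b =>
    Integrable.of_bound (hXm b).aestronglyMeasurable (B + |c|) (ae_of_all _ (hXb b))
  set S : (τ → E) → ℝ := fun ω => ∑ b, X b ω with hSdef
  have hSm : Measurable S := by fun_prop
  have hSb : ∀ ω, |S ω| ≤ Fintype.card ι * (B + |c|) := fun ω => by
    refine (Finset.abs_sum_le_sum_abs _ _).trans ((Finset.sum_le_sum fun b _ => hXb b ω).trans_eq ?_)
    simp [mul_add]
  have hbound : ∀ ω, Real.exp (t * S ω) ≤ Real.exp (|t| * (Fintype.card ι * (B + |c|))) :=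
    fun ω => Real.exp_le_exp.2 <| (le_abs_self _).trans <| by
      rw [abs_mul]
      exact mul_le_mul_of_nonneg_left (hSb ω) (abs_nonneg t)
  have hexpi : ∀ P : Measure (τ → E), IsProbabilityMeasure P →
      Integrable (fun ω => Real.exp (t * S ω)) P := fun P _ =>
    Integrable.of_bound (by fun_prop) _ (ae_of_all _ fun ω => by
      rw [Real.norm_eq_abs, Real.abs_exp]
      exact hbound ω)
  have hjensen : Real.exp (∫ ω, t * S ω ∂(π.tilted g)) ≤ ∫ ω, Real.exp (t * S ω) ∂(π.tilted g) :=
    convexOn_exp.map_integral_le Real.continuous_exp.continuousOn isClosed_univ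
      (ae_of_all _ fun _ => Set.mem_univ _)
      ((integrable_finsetSum _ fun b _ => hXi b).const_mul t) (hexpi _ inferInstance)
  -- The density `exp g / Z` is at most `exp L`, because `Z ≥ 1` and `g ≤ L`.
  have hdens : ∫ ω, Real.exp (t * S ω) ∂(π.tilted g) ≤ Real.exp L * mgf S π t := by
    rw [integral_tilted, mgf, ← integral_const_mul]
    refine integral_mono_of_nonneg (ae_of_all _ fun ω => by simp only [smul_eq_mul]; positivity)
      ((hexpi _ inferInstance).const_mul _) ?_
    filter_upwards [hgL] with ω hω
    refine mul_le_mul_of_nonneg_right ?_ (Real.exp_pos _).le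
    exact (div_le_self (Real.exp_pos _).le hZ).trans (Real.exp_le_exp.2 hω)
  have hmgf := hS.mgf_le t
  have hconst : ((∑ _b : ι, (‖B - -B‖₊ / 2) ^ 2 : NNReal) : ℝ) = Fintype.card ι * B ^ 2 := by
    simp only [Finset.sum_const, Finset.card_univ, nsmul_eq_mul]
    push_cast
    rw [div_pow, Real.norm_eq_abs, sq_abs]
    ring
  rw [hconst] at hmgf
  have hfin : Real.exp (∫ ω, t * S ω ∂(π.tilted g)) ≤
      Real.exp (L + Fintype.card ι * B ^ 2 * t ^ 2 / 2) := by
    rw [Real.exp_add]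
    exact hjensen.trans (hdens.trans (mul_le_mul_of_nonneg_left hmgf (Real.exp_pos _).le))
  rw [Real.exp_le_exp, integral_const_mul, integral_finsetSum _ fun b _ => hXi b] at hfin
  exact hfin

/-- Under an exchangeable law all the injective choices of `κ` particles have the same law. -/
lemma integral_comp_injective_eq {κ τ : Type*} [Fintype τ] {P : Measure (τ → E)}
    (hP : ∀ σ : Equiv.Perm τ, P.map (fun ω i => ω (σ i)) = P) {e e' : κ → τ}
    (he : Function.Injective e) (he' : Function.Injective e') {F : (κ → E) → ℝ}
    (hF : Measurable F) :
    ∫ ω, F (fun i => ω (e i)) ∂P = ∫ ω, F (fun i => ω (e' i)) ∂P := by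
  classical
  -- The partial bijection `e' i ↦ e i`, extended to a permutation of the finite set `τ`.
  let σ : Equiv.Perm τ :=
    ((Equiv.ofInjective e' he').symm.trans (Equiv.ofInjective e he)).extendSubtype
  have hσ : ∀ i, σ (e' i) = e i := fun i => by
    have h := Equiv.extendSubtype_apply_of_mem
      ((Equiv.ofInjective e' he').symm.trans (Equiv.ofInjective e he)) (e' i) ⟨i, rfl⟩
    refine h.trans ?_
    simp [Equiv.ofInjective_symm_apply]
  conv_rhs => rw [← hP σ]
  rw [integral_map (Measurable.aemeasurable (by fun_prop))
    (Measurable.aestronglyMeasurable (by fun_prop))]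
  simp only [hσ]

/-- The tilting of an invariant measure by an invariant function is invariant. -/
lemma tilted_map_eq_self {Ω : Type*} [MeasurableSpace Ω] {μ : Measure Ω} {T : Ω → Ω}
    (hT : Measurable T) (hμ : μ.map T = μ) {g : Ω → ℝ} (hg : Measurable g)
    (hgT : ∀ ω, g (T ω) = g ω) : (μ.tilted g).map T = μ.tilted g := by
  ext s hs
  rw [Measure.map_apply hT hs, tilted_apply' _ _ (hT hs), tilted_apply' _ _ hs]
  conv_rhs => rw [← hμ, setLIntegral_map hs (by fun_prop) hT]
  simp only [hgT, hμ]

/-- Quantitative propagation of chaos: the law of `k` particles under an exchangeable measure whose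
density with respect to the product measure is at most `exp L`. -/
lemma integral_marginal_sub_le {k n M : ℕ} (hM : 0 < M) (hMk : M * k ≤ k + n)
    {g : (Fin (k + n) → E) → ℝ} {L : ℝ}
    (hgi : Integrable (fun ω => Real.exp (g ω)) (Measure.pi fun _ : Fin (k + n) => ρ))
    (hZ : 1 ≤ ∫ ω, Real.exp (g ω) ∂(Measure.pi fun _ : Fin (k + n) => ρ))
    (hgL : ∀ᵐ ω ∂(Measure.pi fun _ : Fin (k + n) => ρ), g ω ≤ L)
    (hP : ∀ σ : Equiv.Perm (Fin (k + n)),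
      ((Measure.pi fun _ : Fin (k + n) => ρ).tilted g).map (fun ω i => ω (σ i)) =
        (Measure.pi fun _ : Fin (k + n) => ρ).tilted g)
    {F : (Fin k → E) → ℝ} (hF : Measurable F) {B : ℝ} (hB : ∀ z, |F z| ≤ B) {t : ℝ} (ht : 0 < t) :
    ∫ ω, F (fun i => ω (Fin.castAdd n i)) ∂((Measure.pi fun _ : Fin (k + n) => ρ).tilted g) -
        ∫ z, F z ∂(Measure.pi fun _ : Fin k => ρ) ≤
      L / M / t + B ^ 2 * t / 2 := by
  have : IsProbabilityMeasure ((Measure.pi fun _ : Fin (k + n) => ρ).tilted g) :=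
    isProbabilityMeasure_tilted hgi
  let e : Fin M × Fin k → Fin (k + n) := fun p => Fin.castLE hMk (finProdFinEquiv p)
  have he : Function.Injective e :=
    (Fin.castLE_injective hMk).comp finProdFinEquiv.injective
  have h := sum_integral_blocks_le ρ he hgi hZ hgL hF hB (t := t)
  -- By exchangeability every block contributes the same as the first `k` particles, so the sum over
  -- blocks is `M` times one term.
  have hterm : ∀ b : Fin M,
      ∫ ω, (F (fun i => ω (e (b, i))) - ∫ z, F z ∂(Measure.pi fun _ : Fin k => ρ))
        ∂((Measure.pi fun _ : Fin (k + n) => ρ).tilted g) =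
      ∫ ω, F (fun i => ω (Fin.castAdd n i)) ∂((Measure.pi fun _ : Fin (k + n) => ρ).tilted g) -
        ∫ z, F z ∂(Measure.pi fun _ : Fin k => ρ) := fun b => by
    rw [integral_sub _ (integrable_const _), integral_const,
      integral_comp_injective_eq hP (e := fun i => e (b, i))
        (he.comp (Prod.mk_right_injective b)) (Fin.castAdd_injective k n) hF]
    · simp
    · exact Integrable.of_bound (Measurable.aestronglyMeasurable (by fun_prop)) B
        (ae_of_all _ fun _ => hB _)
  simp only [hterm, Finset.sum_const, Finset.card_univ, Fintype.card_fin, nsmul_eq_mul] at h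
  have hM' : (0 : ℝ) < M := by exact_mod_cast hM
  rw [← mul_assoc] at h
  refine le_of_mul_le_mul_left (h.trans_eq ?_) (mul_pos ht hM')
  field_simp

end Blocks

/-! ### The regularized Green function: diagonal growth, zero mean, positivity. -/

section Green

/-- The Fourier coefficient `λₙ^(-m/2) exp (-ε λₙ)` of the regularized Green function. -/
noncomputable def greenCoeff (m ε : ℝ) (n : Freq) : ℝ :=
  eigenvalue n ^ (-(m / 2)) * Real.exp (-(ε * eigenvalue n))

/-- The value `∑ₙ λₙ^(-m/2) exp (-ε λₙ)` of the regularized Green function on the diagonal. -/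
noncomputable def greenDiag (m ε : ℝ) : ℝ := ∑' n, greenCoeff m ε n

lemma norm_sq_le_eigenvalue (n : Freq) : ‖n.1‖ ^ 2 ≤ eigenvalue n := by
  have h1 : ‖n.1‖ ^ 2 ≤ ∑ i, ((n.1 i : ℤ) : ℝ) ^ 2 := by
    refine (Real.le_sqrt (norm_nonneg _) (Finset.sum_nonneg fun i _ => sq_nonneg _)).1 ?_
    refine (pi_norm_le_iff_of_nonneg (Real.sqrt_nonneg _)).2 fun i => ?_
    rw [Int.norm_eq_abs]
    exact Real.abs_le_sqrt (Finset.single_le_sum (f := fun i => ((n.1 i : ℤ) : ℝ) ^ 2)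
      (fun i _ => sq_nonneg _) (Finset.mem_univ i))
  have h2 : (1 : ℝ) ≤ (2 * Real.pi) ^ 2 := by nlinarith [Real.pi_gt_three]
  exact h1.trans (le_mul_of_one_le_left (Finset.sum_nonneg fun i _ => sq_nonneg _) h2)

lemma one_le_norm_freq (n : Freq) : 1 ≤ ‖n.1‖ := by
  obtain ⟨i, hi⟩ : ∃ i, n.1 i ≠ 0 := by
    by_contra! h
    exact n.2 (funext h)
  refine le_trans ?_ (norm_le_pi_norm n.1 i)
  rw [Int.norm_eq_abs]
  exact_mod_cast Int.one_le_abs hi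

lemma one_le_eigenvalue (n : Freq) : 1 ≤ eigenvalue n :=
  (one_le_pow₀ (one_le_norm_freq n)).trans (norm_sq_le_eigenvalue n)

/-- Comparison with the lattice sum of `‖n‖⁻⁴` in the sup norm, which converges since `4` exceeds
the dimension `2`. -/
lemma summable_eigenvalue_rpow_neg_two :
    Summable fun n : Freq => eigenvalue n ^ (-2 : ℝ) := by
  have h := (EisensteinSeries.summable_one_div_norm_rpow (k := 4) (by norm_num)).comp_injective
    (Subtype.val_injective (p := fun n : Fin 2 → ℤ => n ≠ 0))
  refine h.of_nonneg_of_le (fun n => Real.rpow_nonneg (by linarith [one_le_eigenvalue n]) _)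
    fun n => ?_
  have hn : 0 < ‖n.1‖ := one_pos.trans_le (one_le_norm_freq n)
  calc eigenvalue n ^ (-2 : ℝ) ≤ (‖n.1‖ ^ 2) ^ (-2 : ℝ) :=
        Real.rpow_le_rpow_of_nonpos (by positivity) (norm_sq_le_eigenvalue n) (by norm_num)
    _ = ‖n.1‖ ^ (-4 : ℝ) := by
        rw [← Real.rpow_natCast, ← Real.rpow_mul hn.le]
        norm_num

lemma greenCoeff_nonneg (m ε : ℝ) (n : Freq) : 0 ≤ greenCoeff m ε n :=
  mul_nonneg (Real.rpow_nonneg (by linarith [one_le_eigenvalue n]) _) (Real.exp_pos _).le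

/-- For a fixed large exponent, the Fourier coefficients are dominated by a summable sequence times
a power of `ε`. -/
lemma greenCoeff_le {m ε : ℝ} (hε : 0 < ε) {p : ℕ} (hp : 2 - m / 2 ≤ p) (n : Freq) :
    greenCoeff m ε n ≤ p.factorial * ε⁻¹ ^ p * eigenvalue n ^ (-2 : ℝ) := by
  have hl : 0 < eigenvalue n := one_pos.trans_le (one_le_eigenvalue n)
  -- Inverse of the bound `x ^ p / p! ≤ exp x` at `x = ε λₙ`.
  have hexp : Real.exp (-(ε * eigenvalue n)) ≤ p.factorial * ε⁻¹ ^ p * eigenvalue n ^ (-(p : ℝ)) := by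
    have h := Real.pow_div_factorial_le_exp (x := ε * eigenvalue n) (by positivity) p
    rw [Real.exp_neg]
    refine (inv_anti₀ (by positivity) h).trans_eq ?_
    rw [Real.rpow_neg hl.le, Real.rpow_natCast, mul_pow, inv_pow]
    field_simp
  calc greenCoeff m ε n
      ≤ eigenvalue n ^ (-(m / 2)) * (p.factorial * ε⁻¹ ^ p * eigenvalue n ^ (-(p : ℝ))) :=
        mul_le_mul_of_nonneg_left hexp (Real.rpow_nonneg hl.le _)
    _ = p.factorial * ε⁻¹ ^ p * eigenvalue n ^ (-(m / 2) + -(p : ℝ)) := by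
        rw [Real.rpow_add hl]
        ring
    _ ≤ p.factorial * ε⁻¹ ^ p * eigenvalue n ^ (-2 : ℝ) := by
        refine mul_le_mul_of_nonneg_left ?_ (by positivity)
        exact Real.rpow_le_rpow_of_exponent_le (one_le_eigenvalue n) (by linarith)

lemma summable_greenCoeff (m : ℝ) {ε : ℝ} (hε : 0 < ε) : Summable (greenCoeff m ε) :=
  (summable_eigenvalue_rpow_neg_two.mul_left _).of_nonneg_of_le (greenCoeff_nonneg m ε)
    (greenCoeff_le hε (Nat.le_ceil _))

lemma greenDiag_nonneg (m ε : ℝ) : 0 ≤ greenDiag m ε := tsum_nonneg (greenCoeff_nonneg m ε)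

lemma exists_greenDiag_le (m : ℝ) :
    ∃ (c : ℝ) (p : ℕ), 0 ≤ c ∧ ∀ ε, 0 < ε → greenDiag m ε ≤ c * ε⁻¹ ^ p := by
  -- Large enough that `λ ^ (-m/2 - p) ≤ λ ^ (-2)`, which is summable.
  set p := ⌈2 - m / 2⌉₊
  refine ⟨p.factorial * ∑' n : Freq, eigenvalue n ^ (-2 : ℝ), p,
    mul_nonneg (by positivity)
      (tsum_nonneg fun n => Real.rpow_nonneg (by linarith [one_le_eigenvalue n]) _),
    fun ε hε => ?_⟩
  refine ((summable_greenCoeff m hε).tsum_le_tsum (greenCoeff_le hε (Nat.le_ceil _))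
    (summable_eigenvalue_rpow_neg_two.mul_left _)).trans_eq ?_
  rw [tsum_mul_left]
  ring

lemma norm_mFourier_apply (n : Fin 2 → ℤ) (x : Torus) : ‖UnitAddTorus.mFourier n x‖ = 1 := by
  simp only [UnitAddTorus.mFourier, ContinuousMap.coe_mk, fourier_apply, norm_prod,
    Circle.norm_coe, Finset.prod_const_one]

lemma abs_mFourier_mul_conj_re_le (n : Fin 2 → ℤ) (x y : Torus) :
    |(UnitAddTorus.mFourier n x * (starRingEnd ℂ) (UnitAddTorus.mFourier n y)).re| ≤ 1 :=
  (Complex.abs_re_le_norm _).trans_eq <| by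
    rw [norm_mul, RCLike.norm_conj, norm_mFourier_apply, norm_mFourier_apply, one_mul]

lemma norm_greenTerm_le (m ε : ℝ) (n : Freq) (x y : Torus) :
    ‖greenCoeff m ε n *
      (UnitAddTorus.mFourier n.1 x * (starRingEnd ℂ) (UnitAddTorus.mFourier n.1 y)).re‖ ≤
      greenCoeff m ε n := by
  rw [norm_mul, Real.norm_eq_abs, abs_of_nonneg (greenCoeff_nonneg m ε n)]
  exact mul_le_of_le_one_right (greenCoeff_nonneg m ε n) (abs_mFourier_mul_conj_re_le _ _ _)

lemma hasSum_greenReg (m : ℝ) {ε : ℝ} (hε : 0 < ε) (x y : Torus) :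
    HasSum (fun n : Freq => greenCoeff m ε n *
      (UnitAddTorus.mFourier n.1 x * (starRingEnd ℂ) (UnitAddTorus.mFourier n.1 y)).re)
      (greenReg m ε x y) :=
  ((summable_greenCoeff m hε).of_norm_bounded fun n => norm_greenTerm_le m ε n x y).hasSum

lemma abs_greenReg_le (m : ℝ) {ε : ℝ} (hε : 0 < ε) (x y : Torus) :
    |greenReg m ε x y| ≤ greenDiag m ε :=
  tsum_of_norm_bounded (summable_greenCoeff m hε).hasSum fun n => norm_greenTerm_le m ε n x y

lemma greenReg_self (m ε : ℝ) (x : Torus) : greenReg m ε x x = greenDiag m ε := by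
  refine tsum_congr fun n => ?_
  rw [Complex.mul_conj, Complex.ofReal_re, Complex.normSq_eq_norm_sq, norm_mFourier_apply]
  simp [greenCoeff]

lemma continuous_greenReg (m : ℝ) {ε : ℝ} (hε : 0 < ε) :
    Continuous fun z : Torus × Torus => greenReg m ε z.1 z.2 :=
  continuous_tsum (fun n => by fun_prop) (summable_greenCoeff m hε)
    fun n z => norm_greenTerm_le m ε n z.1 z.2

/-- Translation by a suitable fraction of the period changes the sign of the character and preserves
Haar measure. -/
lemma integral_fourier_eq_zero {k : ℤ} (hk : k ≠ 0) :
    ∫ x : UnitAddCircle, fourier k x ∂AddCircle.haarAddCircle = 0 :=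
  integral_eq_zero_of_add_right_eq_neg (fourier_add_half_inv_index hk one_pos)

lemma integral_mFourier_eq_zero {n : Fin 2 → ℤ} (hn : n ≠ 0) :
    ∫ x, UnitAddTorus.mFourier n x ∂ell = 0 := by
  obtain ⟨i, hi⟩ : ∃ i, n i ≠ 0 := by
    by_contra! h
    exact hn (funext h)
  have h := integral_fintype_prod_eq_prod (𝕜 := ℂ)
    (μ := fun _ : Fin 2 => (AddCircle.haarAddCircle : Measure UnitAddCircle))
    (fun i x => fourier (n i) x)
  refine h.trans (Finset.prod_eq_zero (Finset.mem_univ i) (integral_fourier_eq_zero hi))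

/-- The zero mode is absent, so the series integrates to zero term by term. -/
lemma integral_greenReg_eq_zero (m : ℝ) {ε : ℝ} (hε : 0 < ε) (x : Torus) :
    ∫ y, greenReg m ε x y ∂ell = 0 := by
  have hint : ∀ n : Freq, Integrable (fun y => greenCoeff m ε n *
      (UnitAddTorus.mFourier n.1 x * (starRingEnd ℂ) (UnitAddTorus.mFourier n.1 y)).re) ell :=
    fun n => Integrable.of_bound (Continuous.aestronglyMeasurable (by fun_prop)) _
      (ae_of_all _ fun y => norm_greenTerm_le m ε n x y)
  have h := integral_tsum_of_summable_integral_norm hint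
    ((summable_greenCoeff m hε).of_nonneg_of_le
      (fun n => integral_nonneg fun _ => norm_nonneg _) fun n => by
        refine (integral_mono_of_nonneg (ae_of_all _ fun _ => norm_nonneg _)
          (integrable_const (greenCoeff m ε n))
          (ae_of_all _ fun y => norm_greenTerm_le m ε n x y)).trans_eq ?_
        simp)
  refine h.symm.trans ?_
  rw [← tsum_zero (α := ℝ) (β := Freq)]
  refine tsum_congr fun n => ?_
  have hi : Integrable (fun y => UnitAddTorus.mFourier n.1 x *
      (starRingEnd ℂ) (UnitAddTorus.mFourier n.1 y)) ell :=
    Integrable.of_bound (Continuous.aestronglyMeasurable (by fun_prop)) 1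
      (ae_of_all _ fun y => by
        rw [norm_mul, RCLike.norm_conj, norm_mFourier_apply, norm_mFourier_apply, one_mul])
  have hre := integral_re hi
  simp only [RCLike.re_eq_complex_re] at hre
  rw [integral_const_mul, hre, integral_const_mul, integral_conj, integral_mFourier_eq_zero n.2]
  simp

/-- The regularized Green function is positive definite. -/
lemma sum_sum_greenReg_nonneg (m : ℝ) {ε : ℝ} (hε : 0 < ε) {ι : Type*} [Fintype ι]
    (γ : ι → ℝ) (x : ι → Torus) :
    0 ≤ ∑ j, ∑ k, γ j * γ k * greenReg m ε (x j) (x k) := by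
  have h : HasSum (fun n : Freq => ∑ j, ∑ k, γ j * γ k * (greenCoeff m ε n *
      (UnitAddTorus.mFourier n.1 (x j) *
        (starRingEnd ℂ) (UnitAddTorus.mFourier n.1 (x k))).re))
      (∑ j, ∑ k, γ j * γ k * greenReg m ε (x j) (x k)) :=
    hasSum_sum fun j _ => hasSum_sum fun k _ => (hasSum_greenReg m hε _ _).mul_left _
  refine h.nonneg fun n => ?_
  -- Each mode contributes its nonnegative coefficient times `|∑ⱼ γⱼ eₙ(xⱼ)|²`.
  have hsq : ∑ j, ∑ k, γ j * γ k * (greenCoeff m ε n *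
      (UnitAddTorus.mFourier n.1 (x j) *
        (starRingEnd ℂ) (UnitAddTorus.mFourier n.1 (x k))).re) =
      greenCoeff m ε n * Complex.normSq (∑ j, γ j * UnitAddTorus.mFourier n.1 (x j)) := by
    rw [← Complex.ofReal_re (Complex.normSq _), ← Complex.mul_conj, map_sum,
      Finset.sum_mul_sum, Complex.re_sum, Finset.mul_sum]
    refine Finset.sum_congr rfl fun j _ => ?_
    rw [Complex.re_sum, Finset.mul_sum]
    refine Finset.sum_congr rfl fun k _ => ?_
    simp only [map_mul, Complex.conj_ofReal, Complex.mul_re, Complex.mul_im, Complex.ofReal_re,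
      Complex.ofReal_im, Complex.conj_re, Complex.conj_im]
    ring
  rw [hsq]
  exact mul_nonneg (greenCoeff_nonneg m ε n) (Complex.normSq_nonneg _)

end Green

/-! ### Bounds on the energy and on the partition function. -/

section Hamiltonian

variable (m : ℝ) {ε : ℝ} (N : ℕ)

lemma hamiltonian_comp_perm (ε : ℝ) (σ : Equiv.Perm (Fin N)) (ω : Fin N → Vortex) :
    hamiltonian m ε N (fun i => ω (σ i)) = hamiltonian m ε N ω := by
  unfold hamiltonian
  congr 1
  refine Finset.sum_equiv σ (by simp) fun j _ => Finset.sum_equiv σ (by simp) fun k _ => rfl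

/-- Adding the missing terms `j = k` completes the sum to a nonnegative quadratic form. -/
lemma neg_greenDiag_mul_le_hamiltonian (hε : 0 < ε) (ω : Fin N → Vortex) :
    -(1 / 2 * greenDiag m ε * ∑ j, (ω j).1 ^ 2) ≤ hamiltonian m ε N ω := by
  have h := sum_sum_greenReg_nonneg m hε (fun j => (ω j).1) (fun j => (ω j).2)
  have hsplit : ∑ j, ∑ k, (ω j).1 * (ω k).1 * greenReg m ε (ω j).2 (ω k).2 =
      (∑ j, ∑ k ∈ Finset.univ.erase j, (ω j).1 * (ω k).1 * greenReg m ε (ω j).2 (ω k).2) +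
        greenDiag m ε * ∑ j, (ω j).1 ^ 2 := by
    rw [Finset.mul_sum, ← Finset.sum_add_distrib]
    refine Finset.sum_congr rfl fun j _ => ?_
    rw [← Finset.sum_erase_add _ _ (Finset.mem_univ j), greenReg_self]
    ring
  rw [hsplit] at h
  unfold hamiltonian
  linarith

lemma measurable_greenReg_comp (hε : 0 < ε) {Ω : Type*} [MeasurableSpace Ω] {f g : Ω → Torus}
    (hf : Measurable f) (hg : Measurable g) : Measurable fun ω => greenReg m ε (f ω) (g ω) := by
  have h : Measurable fun ω => (f ω, g ω) := hf.prodMk hg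
  exact Measurable.comp (g := fun z : Torus × Torus => greenReg m ε z.1 z.2)
    (f := fun ω => (f ω, g ω)) (continuous_greenReg m hε).measurable h

lemma measurable_hamiltonian (hε : 0 < ε) : Measurable (hamiltonian m ε N) := by
  unfold hamiltonian
  refine Measurable.const_mul (Finset.measurable_sum _ fun j _ =>
    Finset.measurable_sum _ fun k _ => ?_) _
  exact Measurable.mul (by fun_prop)
    (measurable_greenReg_comp m hε (by fun_prop) (by fun_prop))

variable (ν : Measure ℝ) [IsProbabilityMeasure ν]

/-- Two independent vortices do not interact on average. -/
lemma integral_interaction (hε : 0 < ε) {R : ℝ} (hR : ∀ᵐ γ ∂ν, |γ| ≤ R) {j k : Fin N}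
    (hjk : j ≠ k) :
    Integrable (fun ω : Fin N → Vortex => (ω j).1 * (ω k).1 * greenReg m ε (ω j).2 (ω k).2)
        (Measure.pi fun _ => ν.prod ell) ∧
      ∫ ω : Fin N → Vortex, (ω j).1 * (ω k).1 * greenReg m ε (ω j).2 (ω k).2
        ∂(Measure.pi fun _ => ν.prod ell) = 0 := by
  set ρ := ν.prod ell
  have hmap : (Measure.pi fun _ : Fin N => ρ).map (fun ω => (ω j, ω k)) = ρ.prod ρ := by
    have hind : iIndepFun (fun (i : Fin N) (ω : Fin N → Vortex) => ω i)
        (Measure.pi fun _ : Fin N => ρ) :=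
      iIndepFun_pi (X := fun _ => id) fun _ => aemeasurable_id
    rw [(indepFun_iff_map_prod_eq_prod_map_map (measurable_pi_apply j).aemeasurable
      (measurable_pi_apply k).aemeasurable).1 (hind.indepFun hjk)]
    congr 1 <;> exact (measurePreserving_eval (fun _ : Fin N => ρ) _).map_eq
  set f : Vortex × Vortex → ℝ := fun z => z.1.1 * z.2.1 * greenReg m ε z.1.2 z.2.2 with hf
  have hfm : Measurable f := Measurable.mul (by fun_prop)
    (measurable_greenReg_comp m hε (by fun_prop) (by fun_prop))
  have hρ : ∀ᵐ z ∂ρ, |z.1| ≤ R := Measure.quasiMeasurePreserving_fst.ae hR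
  have hfi : Integrable f (ρ.prod ρ) := by
    refine Integrable.of_bound hfm.aestronglyMeasurable (R * R * greenDiag m ε) ?_
    filter_upwards [Measure.quasiMeasurePreserving_fst.ae hρ,
      Measure.quasiMeasurePreserving_snd.ae hρ] with z h1 h2
    rw [hf, norm_mul, norm_mul]
    have hR0 : 0 ≤ R := (abs_nonneg _).trans h1
    exact mul_le_mul (mul_le_mul h1 h2 (abs_nonneg _) hR0) (abs_greenReg_le m hε _ _)
      (abs_nonneg _) (mul_nonneg hR0 hR0)
  -- Fubini: for a fixed first vortex, the integral over the second factors, and its position factor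
  -- vanishes.
  have hzero : ∫ z, f z ∂(ρ.prod ρ) = 0 := by
    rw [integral_prod _ hfi]
    refine integral_eq_zero_of_ae (ae_of_all _ fun z => ?_)
    have hfac : ∀ w : Vortex, f (z, w) = (z.1 * w.1) * greenReg m ε z.2 w.2 := fun w => rfl
    simp only [hfac, Pi.zero_apply]
    rw [integral_prod_mul (fun γ => z.1 * γ) (fun y => greenReg m ε z.2 y),
      integral_greenReg_eq_zero m hε, mul_zero]
  rw [← hmap] at hfi hzero
  refine ⟨hfi.comp_measurable (by fun_prop), ?_⟩
  rwa [integral_map (Measurable.aemeasurable (by fun_prop)) hfm.aestronglyMeasurable] at hzero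

lemma integral_hamiltonian (hε : 0 < ε) {R : ℝ} (hR : ∀ᵐ γ ∂ν, |γ| ≤ R) :
    Integrable (hamiltonian m ε N) (Measure.pi fun _ => ν.prod ell) ∧
      ∫ ω, hamiltonian m ε N ω ∂(Measure.pi fun _ => ν.prod ell) = 0 := by
  have h := fun (j k : Fin N) (hk : k ∈ Finset.univ.erase j) =>
    integral_interaction m N ν hε hR (Finset.ne_of_mem_erase hk).symm
  have hi : ∀ j : Fin N, Integrable (fun ω : Fin N → Vortex => ∑ k ∈ Finset.univ.erase j,
      (ω j).1 * (ω k).1 * greenReg m ε (ω j).2 (ω k).2) (Measure.pi fun _ => ν.prod ell) :=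
    fun j => integrable_finsetSum _ fun k hk => (h j k hk).1
  unfold hamiltonian
  refine ⟨(integrable_finsetSum _ fun j _ => hi j).const_mul _, ?_⟩
  rw [integral_const_mul, integral_finsetSum _ fun j _ => hi j]
  refine mul_eq_zero_of_right _ (Finset.sum_eq_zero fun j _ => ?_)
  rw [integral_finsetSum _ fun k hk => (h j k hk).1]
  exact Finset.sum_eq_zero fun k hk => (h j k hk).2

/-- The factor `1/N` cancels the `N` self-interaction terms, so the bound depends on `N` only
through `ε`. -/
lemma neg_hamiltonian_le {β : ℝ} (hβ : 0 < β) (hε : 0 < ε) {R : ℝ}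
    (hR : ∀ᵐ γ ∂ν, |γ| ≤ R) :
    ∀ᵐ ω ∂(Measure.pi fun _ : Fin N => ν.prod ell),
      -(β / N) * hamiltonian m ε N ω ≤ β * greenDiag m ε * R ^ 2 / 2 := by
  have hρ : ∀ᵐ z ∂(ν.prod ell), |z.1| ≤ R := Measure.quasiMeasurePreserving_fst.ae hR
  have hall : ∀ᵐ ω ∂(Measure.pi fun _ : Fin N => ν.prod ell), ∀ i, |(ω i).1| ≤ R :=
    ae_all_iff.2 fun i => (Measure.quasiMeasurePreserving_eval (fun _ => ν.prod ell) i).ae hρ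
  filter_upwards [hall] with ω hω
  have hA := greenDiag_nonneg m ε
  -- For `N = 0` the exponent is zero because `β / 0 = 0`.
  rcases N.eq_zero_or_pos with rfl | hN
  · simp only [Nat.cast_zero, div_zero, neg_zero, zero_mul]
    positivity
  have hsum : ∑ j, (ω j).1 ^ 2 ≤ N * R ^ 2 := by
    refine (Finset.sum_le_sum fun j _ => sq_le_sq.2 ((hω j).trans (le_abs_self R))).trans_eq ?_
    simp
  have hH := neg_greenDiag_mul_le_hamiltonian m N hε ω
  have hN' : (0 : ℝ) < N := by exact_mod_cast hN
  have hlow : -hamiltonian m ε N ω ≤ 1 / 2 * greenDiag m ε * (N * R ^ 2) :=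
    (neg_le.1 hH).trans (mul_le_mul_of_nonneg_left hsum (by positivity))
  calc -(β / N) * hamiltonian m ε N ω = β / N * -hamiltonian m ε N ω := by ring
    _ ≤ β / N * (1 / 2 * greenDiag m ε * (N * R ^ 2)) :=
        mul_le_mul_of_nonneg_left hlow (by positivity)
    _ = β * greenDiag m ε * R ^ 2 / 2 := by field_simp

lemma integrable_exp_neg_hamiltonian {β : ℝ} (hβ : 0 < β) (hε : 0 < ε) {R : ℝ}
    (hR : ∀ᵐ γ ∂ν, |γ| ≤ R) :
    Integrable (fun ω => Real.exp (-(β / N) * hamiltonian m ε N ω))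
      (Measure.pi fun _ : Fin N => ν.prod ell) := by
  refine Integrable.of_bound
    (((measurable_hamiltonian m N hε).const_mul _).exp.aestronglyMeasurable)
    (Real.exp (β * greenDiag m ε * R ^ 2 / 2)) ?_
  filter_upwards [neg_hamiltonian_le m N ν hβ hε hR] with ω hω
  rw [Real.norm_eq_abs, Real.abs_exp]
  exact Real.exp_le_exp.2 hω

/-- Jensen in the form `x + 1 ≤ exp x`, integrated with the energy having mean zero. -/
lemma one_le_partition_function {β : ℝ} (hβ : 0 < β) (hε : 0 < ε) {R : ℝ}
    (hR : ∀ᵐ γ ∂ν, |γ| ≤ R) :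
    1 ≤ ∫ ω, Real.exp (-(β / N) * hamiltonian m ε N ω)
      ∂(Measure.pi fun _ : Fin N => ν.prod ell) := by
  obtain ⟨hi, h0⟩ := integral_hamiltonian m N ν hε hR
  have h : ∫ ω, (-(β / N) * hamiltonian m ε N ω + 1) ∂(Measure.pi fun _ : Fin N => ν.prod ell) =
      1 := by
    rw [integral_add (hi.const_mul _) (integrable_const _), integral_const_mul, h0]
    simp
  refine h.symm.trans_le (integral_mono ((hi.const_mul _).add (integrable_const _))
    (integrable_exp_neg_hamiltonian m N ν hβ hε hR) fun ω => Real.add_one_le_exp _)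

end Hamiltonian

/-! ### Negligible tilting and convergence of the marginals. -/

section Chaos

variable (m : ℝ) {ε : ℝ} (N : ℕ) (ν : Measure ℝ) [IsProbabilityMeasure ν]

lemma canonicalMeasure_map_perm (β : ℝ) (hε : 0 < ε) (σ : Equiv.Perm (Fin N)) :
    (canonicalMeasure m β ε ν N).map (fun ω i => ω (σ i)) = canonicalMeasure m β ε ν N := by
  refine tilted_map_eq_self (by fun_prop) (pi_map_comp_injective _ σ.injective)
    ((measurable_hamiltonian m N hε).const_mul _) fun ω => ?_
  rw [hamiltonian_comp_perm]

/-- The tilting exponent is bounded by a quantity that is negligible with respect to `N`. -/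
lemma tendsto_greenDiag_div {C q : ℝ} (hC : 0 < C) {ε : ℕ → ℝ}
    (hε : ∀ N, 0 < ε N)
    (hεN : ∀ᶠ N : ℕ in atTop, C * Real.log N ^ (-q) ≤ ε N) :
    Tendsto (fun N : ℕ => greenDiag m (ε N) / N) atTop (𝓝 0) := by
  obtain ⟨c, p, hc, hcp⟩ := exists_greenDiag_le m
  have hlog : Tendsto (fun N : ℕ => c * C⁻¹ ^ p * (Real.log N ^ (q * p) / (N : ℝ))) atTop
      (𝓝 0) := by
    have h := (isLittleO_log_rpow_rpow_atTop (q * p) one_pos).tendsto_div_nhds_zero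
    simp only [Real.rpow_one] at h
    simpa using (h.comp tendsto_natCast_atTop_atTop).const_mul (c * C⁻¹ ^ p)
  refine squeeze_zero' (Eventually.of_forall fun N =>
    div_nonneg (greenDiag_nonneg _ _) (Nat.cast_nonneg N)) ?_ hlog
  filter_upwards [hεN, eventually_ge_atTop 2] with N hN hN2
  have hl : 0 < Real.log N := Real.log_pos (by exact_mod_cast hN2)
  have hinv : (ε N)⁻¹ ^ p ≤ C⁻¹ ^ p * Real.log N ^ (q * p) := by
    rw [Real.rpow_mul hl.le, Real.rpow_natCast, ← mul_pow]
    refine pow_le_pow_left₀ (inv_nonneg.2 (hε N).le) ?_ p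
    refine (inv_anti₀ (by positivity) hN).trans_eq ?_
    rw [Real.rpow_neg hl.le, mul_inv, inv_inv]
  calc greenDiag m (ε N) / N ≤ c * (C⁻¹ ^ p * Real.log N ^ (q * p)) / N := by
        gcongr
        exact (hcp _ (hε N)).trans (mul_le_mul_of_nonneg_left hinv hc)
    _ = c * C⁻¹ ^ p * (Real.log N ^ (q * p) / N) := by ring

/-- Convergence of the laws of `k` particles, as soon as `G_{m,ε(N)}(x, x) = o(N)`. -/
lemma tendsto_integral_marginal {β : ℝ} (hβ : 0 < β) {R : ℝ} (hR : ∀ᵐ γ ∂ν, |γ| ≤ R)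
    {ε : ℕ → ℝ} (hε : ∀ N, 0 < ε N)
    (hG : Tendsto (fun N : ℕ => greenDiag m (ε N) / N) atTop (𝓝 0)) {k : ℕ}
    {F : (Fin k → Vortex) → ℝ} (hF : Measurable F) {B : ℝ} (hB : ∀ z, |F z| ≤ B) :
    Tendsto (fun n => ∫ ω, F (fun i => ω (Fin.castAdd n i))
      ∂(canonicalMeasure m β (ε (k + n)) ν (k + n))) atTop
      (𝓝 (∫ z, F z ∂(Measure.pi fun _ : Fin k => ν.prod ell))) := by
  rw [Metric.tendsto_atTop']
  intro δ hδ
  -- Makes the sub-Gaussian error less than `δ / 2`; the `+ 1` covers `B = 0`.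
  set t := δ / (B ^ 2 + 1) with ht
  have ht0 : 0 < t := by positivity
  have hBt : B ^ 2 * t / 2 < δ / 2 := by
    rw [ht, mul_div_assoc', div_div, div_lt_div_iff₀ (by positivity) two_pos]
    nlinarith [sq_nonneg B]
  have hL : Tendsto (fun n : ℕ => β * R ^ 2 / 2 * (2 * (k + 1)) / t *
      (greenDiag m (ε (k + n)) / (k + n : ℕ))) atTop (𝓝 0) := by
    have h := hG.comp (tendsto_add_atTop_nat k)
    simpa [Function.comp_def, add_comm] using h.const_mul (β * R ^ 2 / 2 * (2 * (k + 1)) / t)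
  obtain ⟨n₀, hn₀⟩ := eventually_atTop.1 (hL.eventually (gt_mem_nhds (half_pos hδ)))
  refine ⟨n₀ + 1, fun n hn => ?_⟩
  -- Dividing by `k + 1` rather than `k` also covers `k = 0`; `M` is positive because `n ≥ 1`.
  set M := (k + n) / (k + 1) with hMdef
  have hM : 0 < M := Nat.div_pos (by omega) (by omega)
  have hMk : M * k ≤ k + n :=
    (Nat.mul_le_mul_left M (Nat.le_succ k)).trans (Nat.div_mul_le_self _ _)
  have hMlow : ((k + n : ℕ) : ℝ) ≤ 2 * (k + 1) * M := by
    have h1 : k + n < (k + 1) * (M + 1) := Nat.lt_mul_div_succ _ (Nat.succ_pos k)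
    have h2 : (k + 1) * (M + 1) ≤ (k + 1) * (2 * M) := Nat.mul_le_mul_left _ (by omega)
    have h3 : k + n ≤ 2 * (k + 1) * M := by
      calc k + n ≤ (k + 1) * (2 * M) := (h1.trans_le h2).le
        _ = 2 * (k + 1) * M := by ring
    exact_mod_cast h3
  have hM' : (0 : ℝ) < M := by exact_mod_cast hM
  have hkn : (0 : ℝ) < (k + n : ℕ) := by exact_mod_cast (by omega : 0 < k + n)
  set A := greenDiag m (ε (k + n)) with hA
  have hA0 : 0 ≤ A := greenDiag_nonneg _ _
  have hLt : β * A * R ^ 2 / 2 / M / t < δ / 2 := by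
    refine lt_of_le_of_lt ?_ (hn₀ n (by omega))
    have hinv : (M : ℝ)⁻¹ ≤ 2 * (k + 1) / (k + n : ℕ) := by
      rw [inv_eq_one_div, div_le_div_iff₀ hM' hkn, one_mul]
      exact hMlow
    calc β * A * R ^ 2 / 2 / M / t = β * A * R ^ 2 / 2 / t * (M : ℝ)⁻¹ := by ring
      _ ≤ β * A * R ^ 2 / 2 / t * (2 * (k + 1) / (k + n : ℕ)) :=
          mul_le_mul_of_nonneg_left hinv (by positivity)
      _ = _ := by ring
  -- The one-sided bound is stated for a general `F'` so that it applies to both `F` and `-F`.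
  have key : ∀ F' : (Fin k → Vortex) → ℝ, Measurable F' → (∀ z, |F' z| ≤ B) →
      ∫ ω, F' (fun i => ω (Fin.castAdd n i)) ∂(canonicalMeasure m β (ε (k + n)) ν (k + n)) -
        ∫ z, F' z ∂(Measure.pi fun _ : Fin k => ν.prod ell) < δ := fun F' hF' hB' => by
    refine lt_of_le_of_lt (integral_marginal_sub_le (ν.prod ell) hM hMk
      (integrable_exp_neg_hamiltonian m _ ν hβ (hε _) hR)
      (one_le_partition_function m _ ν hβ (hε _) hR)
      (neg_hamiltonian_le m _ ν hβ (hε _) hR)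
      (canonicalMeasure_map_perm m _ ν β (hε _)) hF' hB' ht0) ?_
    linarith
  have h1 := key F hF hB
  have h2 := key (fun z => -F z) hF.neg fun z => by rw [abs_neg]; exact hB z
  rw [integral_neg, integral_neg] at h2
  rw [Real.dist_eq, abs_lt]
  constructor <;> linarith

end Chaos

end PointVortex

/-! ### The main theorem. -/

open PointVortex

theorem theorem3p1 (m β : ℝ) (hm : m < 2) (hβ : 0 < β)
    (ν : Measure ℝ) [IsProbabilityMeasure ν] (hν : ∃ K : Set ℝ, IsCompact K ∧ ν Kᶜ = 0) :
    ∃ C₀ : ℝ, 0 < C₀ ∧ ∀ C : ℝ, C₀ ≤ C → ∀ ε : ℕ → ℝ,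
      (∀ N, 0 < ε N) → Tendsto ε atTop (𝓝 0) →
      (∀ᶠ N : ℕ in atTop, C * Real.log N ^ (-(2 / (2 - m))) ≤ ε N) →
      (∀ N, IsProbabilityMeasure (PointVortex.canonicalMeasure m β (ε N) ν N)) ∧
      (∀ k : ℕ, PointVortex.WeaklyConverges
        (fun n => PointVortex.firstMarginal k n
          (PointVortex.canonicalMeasure m β (ε (k + n)) ν (k + n)))
        (Measure.pi fun _ : Fin k => ν.prod PointVortex.ell)) ∧
      PointVortex.IsChaotic (ν.prod PointVortex.ell)
        (fun N => PointVortex.canonicalMeasure m β (ε N) ν N) := by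
  obtain ⟨R, hR⟩ : ∃ R : ℝ, ∀ᵐ γ ∂ν, |γ| ≤ R := by
    obtain ⟨K, hK, hνK⟩ := hν
    obtain ⟨R, hR⟩ := hK.isBounded.exists_norm_le
    refine ⟨R, ?_⟩
    filter_upwards [measure_eq_zero_iff_ae_notMem.1 hνK] with γ hγ
    exact hR γ (by simpa using hγ)
  -- Any positive `C₀` would do: a power of `log N` is `o(N)` whatever the constant in front.
  refine ⟨1, one_pos, fun C hC ε hε _ hεN => ?_⟩
  have hG := tendsto_greenDiag_div m (one_pos.trans_le hC) hε hεN
  have hweak : ∀ k : ℕ, WeaklyConverges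
      (fun n => firstMarginal k n (canonicalMeasure m β (ε (k + n)) ν (k + n)))
      (Measure.pi fun _ : Fin k => ν.prod ell) := fun k f => by
    have hfm : Measurable f := f.continuous.measurable
    refine (tendsto_integral_marginal m ν hβ hR hε hG hfm f.norm_coe_le_norm).congr fun n => ?_
    exact (integral_map (Measurable.aemeasurable (by fun_prop)) hfm.aestronglyMeasurable).symm
  refine ⟨fun N => isProbabilityMeasure_tilted
      (integrable_exp_neg_hamiltonian m N ν hβ (hε N) hR), hweak,
    fun N σ => canonicalMeasure_map_perm m N ν β (hε N) σ, fun k φ => ?_⟩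
  have hFm : Measurable fun z : Fin k → Vortex => ∏ i, φ i (z i) :=
    Finset.measurable_prod _ fun i _ =>
      (φ i).continuous.measurable.comp (measurable_pi_apply i)
  have h := tendsto_integral_marginal m ν hβ hR hε hG hFm (B := ∏ i, ‖φ i‖) fun z => by
    rw [Finset.abs_prod]
    exact Finset.prod_le_prod (fun _ _ => abs_nonneg _) fun i _ => (φ i).norm_coe_le_norm _
  rwa [integral_fintype_prod_eq_prod (fun i z => φ i z)] at h
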